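/- Let $p\ge 5$ be a prime and let $H=(\mathbb{Z}/p\mathbb{Z})^*/\{\pm1\}$. Let $B_2(X)=X^2-X+\frac16$ be the second Bernoulli polynomial, let $\langle\cdot\rangle$ denote the fractional part, and let $\operatorname{ord}_p$ be the $p$-adic order on $\mathbb{Q}_p$, normalized by $\operatorname{ord}_p(p)=1$, with $\operatorname{ord}_p(0)=+\infty$. For a character $\chi:H\to\mathbb{Z}_p^*$ put $$S_\chi=\frac p2\sum_{h\in H}\ \sum_{\substack{x\in\mathbb{F}_{p^2}^*/\{\pm1\}\\ \pm x^{p+1}=h}}B_2\left(\left\langle\frac{\frac12\operatorname{Tr}(x)}{p}\right\rangle\right)\chi(h)\in\mathbb{Q}_p ,$$ where $\operatorname{Tr}$ is the trace from $\mathbb{F}_{p^2}$ to $\mathbb{F}_p$ and $\frac12\operatorname{Tr}(x)\in\mathbb{F}_p$ is lifted to an integer. Equivalently, $S_{\chi^{-1}}=\chi(\theta)$ for the Stickelberger element $$\theta=\frac p2\sum_{h\in H}\ \sum_{\pm x^{p+1}=h}B_2\left(\left\langle\frac{\frac12\operatorname{Tr}(x)}{p}\right\rangle\right)h^{-1}\in\mathbb{Q}[H].$$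 Let $\omega:\mathbb{F}_p^*\to\mathbb{Z}_p^*$ be the Teichmüller character, so that $\omega(a)\equiv a \bmod p$, let $\phi=\omega^2$, viewed as a character of $H$, and let $$B'_{2,\phi^j}=B_{2,\omega^{4j}}=p\sum_{a=1}^{p-1}\phi^{2j}(a)\,B_2\left(\frac ap\right)\in\mathbb{Q}_p .$$ If $p\equiv1\bmod 4$, then: 1. $\operatorname{ord}_pS_{\phi^j}=1+\operatorname{ord}_pB'_{2,\phi^j}\ge1$ for all integers $1\le j\le\frac{p-5}4$; 2. $\operatorname{ord}_pS_{\phi^j}=0$ for $j=\frac{p-1}4$; 3. $\operatorname{ord}_pS_{\phi^j}=\operatorname{ord}_pB'_{2,\phi^j}\ge0$ for all integers $\frac{p+3}4\le j\le\frac{p-3}2$. If $p\equiv3\bmod 4$, then: 1. $\operatorname{ord}_pS_{\phi^j}=1+\operatorname{ord}_pB'_{2,\phi^j}\ge1$ for all integers $1\le j\le\frac{p-7}4$; 2. $\operatorname{ord}_pS_{\phi^j}=1+\operatorname{ord}_pB'_{2,\phi^j}=0$ for $j=\frac{p-3}4$; 3. $\operatorname{ord}_pS_{\phi^j}=\operatorname{ord}_pB'_{2,\phi^j}\ge0$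 for all integers $\frac{p+1}4\le j\le\frac{p-3}2$. -/

import Mathlib

noncomputable section

open scoped Classical

namespace CuspidalNS

/-- The group `Rˣ / {±1}`. -/
abbrev UnitsModSign (R : Type*) [CommRing R] : Type _ :=
  Rˣ ⧸ Subgroup.zpowers (-1 : Rˣ)

theorem mem_zpowers_neg_one {R : Type*} [CommRing R] {u : Rˣ}
    (hu : u ∈ Subgroup.zpowers (-1 : Rˣ)) : u = 1 ∨ u = -1 := by
  obtain ⟨n, rfl⟩ := Subgroup.mem_zpowers_iff.mp hu
  rcases Int.even_or_odd n with h | h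
  · exact Or.inl h.neg_one_zpow
  · exact Or.inr h.neg_one_zpow

variable (p : ℕ) [Fact p.Prime]

/-- The field with `p ^ 2` elements. -/
abbrev Fq : Type := GaloisField p 2

/-- `H = (ℤ/pℤ)ˣ / {±1}`. -/
abbrev H : Type := UnitsModSign (ZMod p)

instance instFintypeH : Fintype (H p) := Fintype.ofFinite _

instance instFintypeFq : Fintype (UnitsModSign (Fq p)) := Fintype.ofFinite _

/-- The rational number `B₂(⟨t / p⟩)` for a residue class `t` modulo `p`: the representative
`t.val` lies in `[0, p)`, so `t.val / p` is the fractional part. -/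
def b2 (t : ZMod p) : ℚ := (Polynomial.bernoulli 2).eval ((t.val : ℚ) / p)

theorem b2_neg (t : ZMod p) : b2 p (-t) = b2 p t := by
  have hp : (p : ℚ) ≠ 0 := by exact_mod_cast (Fact.out : p.Prime).ne_zero
  by_cases ht : t = 0
  · simp [ht]
  · have : NeZero t := ⟨ht⟩
    have h : (((-t).val : ℕ) : ℚ) / p = 1 - (t.val : ℚ) / p := by
      rw [ZMod.val_neg_of_ne_zero, Nat.cast_sub (ZMod.val_lt t).le]
      field_simp
    rw [b2, b2, h, Polynomial.bernoulli_eval_one_sub]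
    norm_num

/-- The function `x ↦ B₂(⟨(½ Tr x) / p⟩)` on `𝔽_{p²}ˣ / {±1}`. -/
def b2HalfTrace (x : UnitsModSign (Fq p)) : ℚ :=
  Quotient.liftOn' x
    (fun u : (Fq p)ˣ => b2 p (2⁻¹ * Algebra.trace (ZMod p) (Fq p) (u : Fq p)))
    (by
      intro u v huv
      rw [QuotientGroup.leftRel_apply] at huv
      rcases mem_zpowers_neg_one huv with h | h
      · rw [inv_mul_eq_one.mp h]
      · have hv : v = -u := by
          rw [inv_mul_eq_iff_eq_mul.mp h, mul_neg, mul_one]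
        simp only [hv, Units.val_neg, map_neg, mul_neg, b2_neg])

/-- The map `±x ↦ ±x ^ (p + 1)` from `𝔽_{p²}ˣ / {±1}` to `H`, given by the norm of
`𝔽_{p²}` over `𝔽_p`. -/
def normMod : UnitsModSign (Fq p) →* H p :=
  QuotientGroup.map _ _ (Units.map (Algebra.norm (ZMod p) (S := Fq p)))
    (by
      rw [Subgroup.zpowers_le, Subgroup.mem_comap]
      have h : Units.map (Algebra.norm (ZMod p) (S := Fq p)) (-1) = 1 := by
        ext
        have h1 : (-1 : Fq p) = algebraMap (ZMod p) (Fq p) (-1) := by simp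
        rw [Units.coe_map, Units.val_neg, Units.val_one, h1]
        erw [Algebra.norm_algebraMap]
        rw [GaloisField.finrank p (by norm_num : (2 : ℕ) ≠ 0)]
        simp
      rw [h]
      exact one_mem _)

theorem normMod_mk (u : (Fq p)ˣ) :
    normMod p (QuotientGroup.mk u) =
      QuotientGroup.mk (Units.map (Algebra.norm (ZMod p) (S := Fq p)) u) := rfl

/-- The norm is indeed `x ↦ x ^ (p + 1)`. -/
theorem algebraMap_norm_Fq (x : Fq p) :
    algebraMap (ZMod p) (Fq p) (Algebra.norm (ZMod p) x) = x ^ (p + 1) := by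
  have hp : 0 < p - 1 := Nat.sub_pos_of_lt (Fact.out : p.Prime).one_lt
  rw [FiniteField.algebraMap_norm_eq_pow, GaloisField.card p 2 (by norm_num), Nat.card_zmod]
  congr 1
  have : p ^ 2 - 1 = (p + 1) * (p - 1) := by
    simpa using Nat.sq_sub_sq p 1
  rw [this, Nat.mul_div_cancel _ hp]

/-- The Stickelberger element `θ ∈ ℚ[H]`. -/
def stickelberger : MonoidAlgebra ℚ (H p) :=
  ((p : ℚ) / 2) • ∑ h : H p, ∑ x : UnitsModSign (Fq p) with normMod p x = h,
    MonoidAlgebra.single h⁻¹ (b2HalfTrace p x)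

/-- A character `χ : H → ℤ_pˣ`, read as a multiplicative map to `ℚ_p`. -/
def charHom (χ : H p →* ℤ_[p]ˣ) : H p →* ℚ_[p] :=
  (PadicInt.Coe.ringHom : ℤ_[p] →+* ℚ_[p]).toMonoidHom.comp ((Units.coeHom ℤ_[p]).comp χ)

/-- The number
`S_χ = (p / 2) ∑_{h ∈ H} ∑_{x ∈ 𝔽_{p²}ˣ / {±1}, ±x^{p+1} = h} B₂(⟨(½ Tr x) / p⟩) χ(h)`. -/
def S (χ : H p →* ℤ_[p]ˣ) : ℚ_[p] :=
  ((p : ℚ_[p]) / 2) * ∑ h : H p, ∑ x : UnitsModSign (Fq p) with normMod p x = h,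
    ((b2HalfTrace p x : ℚ) : ℚ_[p]) * charHom p χ h

/-- `χ(θ) = S_{χ⁻¹}`. -/
theorem lift_stickelberger (χ : H p →* ℤ_[p]ˣ) :
    MonoidAlgebra.lift ℚ ℚ_[p] (H p) (charHom p χ) (stickelberger p) = S p χ⁻¹ := by
  have h (g : H p) : charHom p χ g⁻¹ = charHom p χ⁻¹ g := by
    simp [charHom]
  rw [stickelberger, S, map_smul, map_sum, Algebra.smul_def]
  congr 1
  · simp
  · refine Finset.sum_congr rfl fun g _ => ?_
    rw [map_sum]
    refine Finset.sum_congr rfl fun x _ => ?_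
    rw [MonoidAlgebra.lift_single, h, Algebra.smul_def]
    simp

/-- The Teichmüller character `ω : 𝔽_pˣ → ℤ_pˣ`. -/
def teichmuller : (ZMod p)ˣ →* ℤ_[p]ˣ :=
  Units.map ((WittVector.equiv p).toRingHom.toMonoidHom.comp (WittVector.teichmuller p))

/-- `ω(a) ≡ a mod p`. -/
theorem toZMod_teichmuller (a : (ZMod p)ˣ) :
    PadicInt.toZMod (teichmuller p a : ℤ_[p]) = (a : ZMod p) := by
  let f : ℤ_[p] →+* ZMod p :=
    WittVector.constantCoeff.comp (WittVector.equiv p).symm.toRingHom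
  have hf (x : ℤ_[p]) : f x = PadicInt.toZMod x := by
    have hs : Function.Surjective f := ZMod.ringHom_surjective f
    have : (RingHom.ker f).IsMaximal := RingHom.ker_isMaximal_of_surjective f hs
    have hk : RingHom.ker f = IsLocalRing.maximalIdeal ℤ_[p] := IsLocalRing.eq_maximalIdeal this
    have hx : x - ((PadicInt.toZMod x).val : ℤ_[p]) ∈ RingHom.ker f := by
      rw [hk, ← PadicInt.ker_toZMod, RingHom.mem_ker, map_sub, map_natCast,
        ZMod.natCast_zmod_val, sub_self]
    rw [RingHom.mem_ker, map_sub, sub_eq_zero, map_natCast, ZMod.natCast_zmod_val] at hx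
    exact hx
  rw [← hf]
  simp [f, teichmuller]

/-- The character `φ = ω²`, viewed as a character on `H`. -/
def phi : H p →* ℤ_[p]ˣ :=
  QuotientGroup.lift _ (teichmuller p ^ 2)
    (by
      intro u hu
      rcases mem_zpowers_neg_one hu with rfl | rfl
      · simp
      · rw [MonoidHom.mem_ker, MonoidHom.pow_apply, ← map_pow]
        simp)

theorem phi_mk (a : (ZMod p)ˣ) : phi p (QuotientGroup.mk a) = teichmuller p a ^ 2 := rfl

/-- The generalized Bernoulli number `B_{2,χ} = p ∑_{a=1}^{p-1} χ(a) B₂(a / p)` of a character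
`χ` modulo `p` with values in `ℤ_pˣ`. -/
def genBernoulli2 (χ : (ZMod p)ˣ →* ℤ_[p]ˣ) : ℚ_[p] :=
  (p : ℚ_[p]) * ∑ a : (ZMod p)ˣ, ((χ a : ℤ_[p]) : ℚ_[p]) * ((b2 p (a : ZMod p) : ℚ) : ℚ_[p])

/-- `B'_{2,ψ} = B_{2,ψ²}` for a character `ψ` of `H`, its square being viewed as a character
modulo `p`. -/
def bPrime (ψ : H p →* ℤ_[p]ˣ) : ℚ_[p] :=
  genBernoulli2 p ((ψ ^ 2).comp (QuotientGroup.mk' _))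

/-- `B'_{2,φ^j} = B_{2,ω^{4j}}`. -/
theorem bPrime_phi_pow (j : ℕ) :
    bPrime p (phi p ^ j) = genBernoulli2 p (teichmuller p ^ (4 * j)) := by
  have : ((phi p ^ j) ^ 2).comp (QuotientGroup.mk' _) = teichmuller p ^ (4 * j) := by
    ext a
    simp only [MonoidHom.comp_apply, MonoidHom.pow_apply, QuotientGroup.mk'_apply, phi_mk]
    rw [← pow_mul, ← pow_mul, show 2 * (j * 2) = 4 * j by ring]
  rw [bPrime, this]

/-- The `p`-adic order on `ℚ_p`, normalized by `ord_p p = 1`, with `ord_p 0 = ⊤`. -/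
abbrev ordp (x : ℚ_[p]) : WithTop ℤ := Padic.addValuation x

end CuspidalNS

end

open CuspidalNS

namespace CuspidalNS

open scoped Classical

/-! The sum `S` splits into a Jacobi sum times a Bernoulli number. Take a nonsquare `d` and `s ∈
𝔽_{p²}` with `s² = d`. For `x = a + bs` the half trace is `a` and the norm is `a² - db²`. For `a ≠
0` the substitution `b = ac` pulls `ω^{4j}(a)` out of the sum over `b` and leaves `∑_c ω^{2j}(1 -
dc²) = -J(ω^{2j}, ω^{(p-1)/2})`. Hence `4S = -J · B'` plus a contribution from `a = 0`, which
vanishes unless `p - 1 ∣ 4j` (`four_mul_S_eq`).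

The order of `J` comes from its reduction mod `p`, a signed binomial coefficient: `J` is a unit when
`4j ≥ p - 1` (`isUnit_jacobiSum`). When `4j < p - 1` it is `p` times a unit, because `p ∣ J` and
`J(χ,ψ) J(χ⁻¹,ψ⁻¹) = p` (`jacobiSum_eq_mul_unit`).

The order of `B'` is controlled by `p B_{2,ω^k} ≡ ∑ a^{k+2} mod p` for nontrivial `ω^k`: `B'` is
integral unless `p - 1 ∣ k + 2`, where its order is `-1`. If `4j = p - 1`, then `6B' = 1 - p`, and
`24S ≡ -J mod p` is a unit. -/

theorem sum_comp_quotientMk {G M : Type*} [Group G] [Fintype G] [AddCommMonoid M] (s : Subgroup G)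
    [Fintype (G ⧸ s)] (f : G ⧸ s → M) :
    ∑ g : G, f (QuotientGroup.mk g) = Nat.card s • ∑ q, f q := by
  rw [← Finset.sum_fiberwise Finset.univ (fun g : G => (QuotientGroup.mk g : G ⧸ s)),
    Finset.smul_sum]
  refine Finset.sum_congr rfl fun q _ => ?_
  have hc : (Finset.univ.filter fun g : G => (QuotientGroup.mk g : G ⧸ s) = q).card
      = Nat.card s := by
    have := Nat.card_congr (QuotientGroup.preimageMkEquivSubgroupProdSet s {q})
    rw [Nat.card_prod, Nat.card_unique (α := ({q} : Set (G ⧸ s))), mul_one] at this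
    rw [← this, ← Fintype.card_subtype, ← Nat.card_eq_fintype_card]
    rfl
  rw [← hc, ← Finset.sum_const]
  exact Finset.sum_congr rfl fun g hg => by rw [(Finset.mem_filter.mp hg).2]

theorem sum_units_eq_sum {F M : Type*} [Field F] [Fintype F] [Fintype Fˣ] [AddCommMonoid M]
    (f : F → M) (h0 : f 0 = 0) : ∑ u : Fˣ, f u = ∑ x, f x := by
  rw [← Finset.sum_subset (Finset.subset_univ (Finset.univ.filter fun a : F => a ≠ 0))]
  · refine Finset.sum_bij (fun u _ => (u : F)) ?_ ?_ ?_ ?_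
    · intro u _; simp
    · intro u _ v _ h; exact Units.ext h
    · intro a ha
      exact ⟨Units.mk0 a (Finset.mem_filter.mp ha).2, Finset.mem_univ _, rfl⟩
    · intro u _; rfl
  · intro a _ ha
    have : a = 0 := by simpa using ha
    rw [this, h0]

/-! ### Powers of the Teichmüller character and their reduction mod `p`. -/

variable (p : ℕ) [Fact p.Prime]

/-- The Teichmüller character, extended by zero to a multiplicative character of `ZMod p`. -/
noncomputable def omegaChar : MulChar (ZMod p) ℤ_[p] := MulChar.ofUnitHom (teichmuller p)

theorem omegaChar_pow_coe (k : ℕ) (a : (ZMod p)ˣ) :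
    (omegaChar p ^ k) (a : ZMod p) = ((teichmuller p a : ℤ_[p])) ^ k := by
  rw [MulChar.pow_apply_coe, omegaChar, MulChar.ofUnitHom_coe]

theorem toZMod_omegaChar_pow {k : ℕ} (hk : k ≠ 0) (a : ZMod p) :
    PadicInt.toZMod ((omegaChar p ^ k) a) = a ^ k := by
  by_cases ha : a = 0
  · subst ha
    rw [MulChar.map_zero, map_zero, zero_pow hk]
  · lift a to (ZMod p)ˣ using isUnit_iff_ne_zero.mpr ha
    rw [omegaChar_pow_coe, map_pow, toZMod_teichmuller]

theorem omegaChar_pow_card_sub_one : omegaChar p ^ (p - 1) = 1 := by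
  simpa [ZMod.card_units_eq_totient, Nat.totient_prime (Fact.out : p.Prime)]
    using MulChar.pow_card_eq_one (omegaChar p)

theorem omegaChar_pow_ne_one {k : ℕ} (hk : ¬ (p - 1) ∣ k) : omegaChar p ^ k ≠ 1 := by
  intro h
  apply hk
  have hk0 : k ≠ 0 := by rintro rfl; exact hk (dvd_zero _)
  have := (FiniteField.forall_pow_eq_one_iff (ZMod p) k).mp fun a => by
    ext
    rw [Units.val_pow_eq_pow_val, ← toZMod_omegaChar_pow p hk0, h, MulChar.one_apply_coe]
    simp
  rwa [ZMod.card] at this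

theorem sum_pow_zmod (i : ℕ) (hi : i ≠ 0) :
    ∑ a : ZMod p, a ^ i = if (p - 1) ∣ i then -1 else 0 := by
  have h := FiniteField.sum_pow_units (ZMod p) i
  rw [ZMod.card] at h
  rw [← h, ← sum_units_eq_sum (fun a : ZMod p => a ^ i) (zero_pow hi)]

/-! ### Jacobi sums and their `p`-adic orders. -/

/-- After binomial expansion only exponents `a + k` divisible by `p - 1` survive; since `0 < a + k <
2(p - 1)`, that forces `k = p - 1 - a`. -/
theorem sum_pow_mul_one_sub_pow {a b : ℕ} (ha : 0 < a) (hap : a < p - 1) (hb : b < p - 1) :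
    ∑ u : ZMod p, u ^ a * (1 - u) ^ b = -((-1) ^ (p - 1 - a) * (b.choose (p - 1 - a) : ZMod p)) := by
  have h1 (u : ZMod p) : u ^ a * (1 - u) ^ b =
      ∑ k ∈ Finset.range (b + 1), ((-1) ^ k * (b.choose k : ZMod p)) * u ^ (a + k) := by
    rw [sub_eq_add_neg, add_comm 1 (-u), add_pow, Finset.mul_sum]
    refine Finset.sum_congr rfl fun k _ => ?_
    rw [neg_pow, pow_add]; ring
  simp_rw [h1]
  rw [Finset.sum_comm]
  simp_rw [← Finset.mul_sum]
  have h2 : ∀ k ∈ Finset.range (b + 1),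
      ((-1) ^ k * (b.choose k : ZMod p)) * ∑ u : ZMod p, u ^ (a + k) =
      if p - 1 - a = k then -((-1) ^ k * (b.choose k : ZMod p)) else 0 := by
    intro k hk
    have hk := Finset.mem_range.mp hk
    rw [sum_pow_zmod p _ (by omega)]
    have : p - 1 ∣ a + k ↔ p - 1 - a = k := by
      constructor
      · rintro ⟨m, hm⟩
        have : m = 1 := by
          have h1 : m < 2 := by by_contra h; nlinarith [Nat.mul_le_mul_left (p-1) (not_lt.mp h)]
          have h2 : m ≠ 0 := by rintro rfl; omega
          omega
        subst this; omega
      · intro h; exact ⟨1, by omega⟩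
    simp only [this]
    split_ifs <;> simp
  rw [Finset.sum_congr rfl h2, Finset.sum_ite_eq]
  split_ifs with h
  · rfl
  · rw [Nat.choose_eq_zero_of_lt (by have := Finset.mem_range.not.mp h; omega)]; simp

theorem toZMod_jacobiSum {a b : ℕ} (ha : 0 < a) (hap : a < p - 1) (hb0 : 0 < b) (hb : b < p - 1) :
    PadicInt.toZMod (jacobiSum (omegaChar p ^ a) (omegaChar p ^ b)) =
      -((-1) ^ (p - 1 - a) * (b.choose (p - 1 - a) : ZMod p)) := by
  rw [← sum_pow_mul_one_sub_pow p ha hap hb, jacobiSum, map_sum]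
  simp_rw [map_mul, toZMod_omegaChar_pow p ha.ne', toZMod_omegaChar_pow p hb0.ne']

theorem isUnit_iff_toZMod_ne_zero (x : ℤ_[p]) : IsUnit x ↔ PadicInt.toZMod x ≠ 0 := by
  rw [← not_iff_not, not_not, ← RingHom.mem_ker, PadicInt.ker_toZMod, IsLocalRing.mem_maximalIdeal,
    mem_nonunits_iff]

theorem dvd_iff_toZMod_eq_zero (x : ℤ_[p]) : (p : ℤ_[p]) ∣ x ↔ PadicInt.toZMod x = 0 := by
  rw [← RingHom.mem_ker, PadicInt.ker_toZMod, PadicInt.maximalIdeal_eq_span_p,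
    Ideal.mem_span_singleton]

theorem isUnit_jacobiSum {a b : ℕ} (hap : a < p - 1) (hb : b < p - 1)
    (hab : p - 1 ≤ a + b) : IsUnit (jacobiSum (omegaChar p ^ a) (omegaChar p ^ b)) := by
  rw [isUnit_iff_toZMod_ne_zero, toZMod_jacobiSum p (by omega) hap (by omega) hb]
  refine neg_ne_zero.mpr (mul_ne_zero (pow_ne_zero _ (by simp)) ?_)
  rw [Ne, ZMod.natCast_eq_zero_iff, ← (Fact.out : p.Prime).coprime_iff_not_dvd]
  exact Nat.Prime.coprime_choose_of_lt Fact.out (by omega) (by omega)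

theorem jacobiSum_eq_mul_unit {a b : ℕ} (ha : 0 < a) (hb : 0 < b) (hab : a + b < p - 1) :
    ∃ u : ℤ_[p]ˣ, jacobiSum (omegaChar p ^ a) (omegaChar p ^ b) = p * u := by
  have hd : (p : ℤ_[p]) ∣ jacobiSum (omegaChar p ^ a) (omegaChar p ^ b) := by
    rw [dvd_iff_toZMod_eq_zero, toZMod_jacobiSum p ha (by omega) hb (by omega),
      Nat.choose_eq_zero_of_lt (by omega)]
    simp
  obtain ⟨v, hv⟩ := hd
  have hne {k : ℕ} (h0 : 0 < k) (hk : k < p - 1) : omegaChar p ^ k ≠ 1 :=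
    omegaChar_pow_ne_one p fun h => by have := Nat.le_of_dvd h0 h; omega
  let f : ℤ_[p] →+* ℚ_[p] := PadicInt.Coe.ringHom
  have hf : Function.Injective f := Subtype.coe_injective
  -- The product formula is applied over the field `ℚ_p` and pulled back to `ℤ_p`; cancelling `p`
  -- makes the cofactor `v` invertible.
  have hprod : jacobiSum (omegaChar p ^ a) (omegaChar p ^ b) *
      jacobiSum (omegaChar p ^ a)⁻¹ (omegaChar p ^ b)⁻¹ = p := by
    apply hf
    rw [map_mul, ← jacobiSum_ringHomComp, ← jacobiSum_ringHomComp, ← MulChar.ringHomComp_inv,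
      ← MulChar.ringHomComp_inv, jacobiSum_mul_jacobiSum_inv]
    · rw [ZMod.card, map_natCast]
    · rw [ringChar.eq_zero, ZMod.ringChar_zmod_n]; exact (Fact.out : p.Prime).ne_zero.symm
    · exact (MulChar.ringHomComp_ne_one_iff hf).mpr (hne ha (by omega))
    · exact (MulChar.ringHomComp_ne_one_iff hf).mpr (hne hb (by omega))
    · rw [← MulChar.ringHomComp_mul, ← pow_add]
      exact (MulChar.ringHomComp_ne_one_iff hf).mpr (hne (by omega) hab)
  rw [hv, mul_assoc] at hprod
  have hp0 : (p : ℤ_[p]) ≠ 0 := by exact_mod_cast (Fact.out : p.Prime).ne_zero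
  have hu : IsUnit v := IsUnit.of_mul_eq_one _ (mul_left_cancel₀ hp0 (hprod.trans (mul_one _).symm))
  exact ⟨hu.unit, hv⟩

/-- At `a ≠ 0` both sides are `±1`, and Euler's criterion makes them agree mod `p`, where `1 ≠ -1`.
-/
theorem omegaChar_pow_half (hp : p ≠ 2) (a : ZMod p) :
    (omegaChar p ^ ((p - 1) / 2)) a = ((quadraticChar (ZMod p) a : ℤ) : ℤ_[p]) := by
  have hodd : (p - 1) / 2 * 2 = p - 1 := by
    have := (Fact.out : p.Prime).eq_two_or_odd'.resolve_left hp
    obtain ⟨m, hm⟩ := this; omega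
  have hp2 := (Fact.out : p.Prime).two_le
  by_cases ha : a = 0
  · subst ha; rw [MulChar.map_zero, MulChar.map_zero, Int.cast_zero]
  · have hsq : ((omegaChar p ^ ((p - 1) / 2)) a) ^ 2 = 1 := by
      rw [← MulChar.pow_apply' _ two_ne_zero, ← pow_mul, hodd, omegaChar_pow_card_sub_one,
        MulChar.one_apply (isUnit_iff_ne_zero.mpr ha)]
    have hred : PadicInt.toZMod ((omegaChar p ^ ((p - 1) / 2)) a) =
        ((quadraticChar (ZMod p) a : ℤ) : ZMod p) := by
      rw [toZMod_omegaChar_pow p (by omega), quadraticChar_eq_pow_of_char_ne_two'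
        (by rwa [ZMod.ringChar_zmod_n]), ZMod.card]
      congr 1; omega
    have h11 : (-1 : ZMod p) ≠ 1 := by
      have : Fact (2 < p) := ⟨by omega⟩
      exact ZMod.neg_one_ne_one
    rcases (sq_eq_sq_iff_eq_or_eq_neg.mp (hsq.trans (one_pow 2).symm)) with h | h <;>
    rcases quadraticChar_dichotomy ha with h' | h' <;> rw [h, h'] at hred ⊢ <;> simp at hred ⊢
    · exact absurd hred.symm h11
    · exact absurd hred h11

/-- Group by `u = dc²`: as `d` is a nonsquare, `u` has `1 - η(u)` preimages, with `η` the quadratic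
character. The term `1` contributes a vanishing character sum. -/
theorem sum_omegaChar_one_sub_mul_sq (hp : p ≠ 2) {d : ZMod p} (hd : ¬ IsSquare d) {k : ℕ}
    (hk : omegaChar p ^ k ≠ 1) :
    ∑ c : ZMod p, (omegaChar p ^ k) (1 - d * c ^ 2) =
      -jacobiSum (omegaChar p ^ k) (omegaChar p ^ ((p - 1) / 2)) := by
  have hd0 : d ≠ 0 := by rintro rfl; exact hd (IsSquare.zero)
  rw [← Finset.sum_fiberwise Finset.univ (fun c : ZMod p => d * c ^ 2)]
  have h (u : ZMod p) : ∑ c : ZMod p with d * c ^ 2 = u, (omegaChar p ^ k) (1 - d * c ^ 2) =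
      (omegaChar p ^ k) (1 - u) - (omegaChar p ^ k) (1 - u) * (omegaChar p ^ ((p - 1) / 2)) u := by
    have hcard := quadraticChar_card_sqrts (F := ZMod p) (by rwa [ZMod.ringChar_zmod_n]) (u / d)
    have hset : {x : ZMod p | x ^ 2 = u / d}.toFinset =
        Finset.univ.filter fun c : ZMod p => d * c ^ 2 = u := by
      ext c; simp [eq_div_iff hd0, mul_comm]
    have hq : quadraticChar (ZMod p) (u / d) = - quadraticChar (ZMod p) u := by
      have h1 : quadraticChar (ZMod p) (u / d) * quadraticChar (ZMod p) d =
        quadraticChar (ZMod p) u := by rw [← map_mul, div_mul_cancel₀ _ hd0]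
      rw [quadraticChar_neg_one_iff_not_isSquare.mpr hd] at h1
      linarith
    rw [hset, hq] at hcard
    rw [Finset.sum_congr rfl (g := fun _ => (omegaChar p ^ k) (1 - u))
      fun c hc => by rw [(Finset.mem_filter.mp hc).2], Finset.sum_const, nsmul_eq_mul,
      omegaChar_pow_half p hp]
    have hcard' := congrArg (Int.cast : ℤ → ℤ_[p]) hcard
    push_cast at hcard'
    rw [hcard']; ring
  simp_rw [h]
  rw [Finset.sum_sub_distrib, jacobiSum_comm, jacobiSum,
    show ∑ u : ZMod p, (omegaChar p ^ k) (1 - u) = ∑ u, (omegaChar p ^ k) u from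
      (Equiv.subLeft (1 : ZMod p)).sum_comp (fun u => (omegaChar p ^ k) u),
    MulChar.sum_eq_zero_of_ne_one hk, zero_sub]
  simp_rw [mul_comm]

/-! ### `S` as a sum over the quadratic extension, in coordinates. -/

noncomputable instance instFintypeFqField : Fintype (Fq p) := Fintype.ofFinite _

theorem card_zpowers_neg_one {R : Type*} [CommRing R] (h : (-1 : R) ≠ 1) :
    Nat.card (Subgroup.zpowers (-1 : Rˣ)) = 2 := by
  rw [Nat.card_zpowers]
  refine orderOf_eq_prime (by simp) fun h1 => h ?_
  simpa using congrArg (Units.val) h1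

theorem neg_one_ne_one_Fq (hp : p ≠ 2) : (-1 : Fq p) ≠ 1 :=
  Ring.neg_one_ne_one_of_char_ne_two (by rwa [ringChar.eq (Fq p) p])

/-- One factor 2 clears `p / 2`; the other counts the two lifts of each class modulo `±1`. -/
theorem four_mul_S (hp : p ≠ 2) (j : ℕ) :
    4 * S p (phi p ^ j) = p * ∑ x : Fq p,
      ((b2 p (2⁻¹ * Algebra.trace (ZMod p) (Fq p) x) : ℚ) : ℚ_[p]) *
        ((omegaChar p ^ (2 * j)) (Algebra.norm (ZMod p) x) : ℤ_[p]) := by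
  have h1 : S p (phi p ^ j) = (p : ℚ_[p]) / 2 * ∑ x : UnitsModSign (Fq p),
      ((b2HalfTrace p x : ℚ) : ℚ_[p]) * charHom p (phi p ^ j) (normMod p x) := by
    rw [S]
    congr 1
    rw [← Finset.sum_fiberwise Finset.univ (normMod p)]
    refine Finset.sum_congr rfl fun h _ => Finset.sum_congr rfl fun x hx => ?_
    rw [(Finset.mem_filter.mp hx).2]
  have h2 := sum_comp_quotientMk (Subgroup.zpowers (-1 : (Fq p)ˣ))
    fun x => ((b2HalfTrace p x : ℚ) : ℚ_[p]) * charHom p (phi p ^ j) (normMod p x)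
  rw [card_zpowers_neg_one (neg_one_ne_one_Fq p hp)] at h2
  rw [h1, ← sum_units_eq_sum (fun x : Fq p =>
      ((b2 p (2⁻¹ * Algebra.trace (ZMod p) (Fq p) x) : ℚ) : ℚ_[p]) *
        ((omegaChar p ^ (2 * j)) (Algebra.norm (ZMod p) x) : ℤ_[p]))]
  · have h3 (u : (Fq p)ˣ) : ((b2HalfTrace p (QuotientGroup.mk u) : ℚ) : ℚ_[p]) *
        charHom p (phi p ^ j) (normMod p (QuotientGroup.mk u)) =
        ((b2 p (2⁻¹ * Algebra.trace (ZMod p) (Fq p) u) : ℚ) : ℚ_[p]) *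
        ((omegaChar p ^ (2 * j)) (Algebra.norm (ZMod p) (u : Fq p)) : ℤ_[p]) := by
      congr 1
      have := omegaChar_pow_coe p (2 * j) (Units.map (Algebra.norm (ZMod p) (S := Fq p)) u)
      rw [Units.coe_map] at this
      erw [this]
      rw [normMod_mk, charHom]
      simp only [MonoidHom.comp_apply, MonoidHom.pow_apply, phi_mk]
      simp [pow_mul]
      rfl
    simp_rw [← h3]
    rw [h2, nsmul_eq_mul]
    push_cast
    ring
  · simp only [map_zero, Algebra.norm_zero, MulChar.map_zero, PadicInt.coe_zero, mul_zero]

theorem exists_sq_eq_nonsquare (hp : p ≠ 2) : ∃ (d : ZMod p) (s : Fq p), ¬ IsSquare d ∧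
    s ^ 2 = algebraMap (ZMod p) (Fq p) d := by
  obtain ⟨d, hd⟩ := FiniteField.exists_nonsquare (F := ZMod p) (by rwa [ZMod.ringChar_zmod_n])
  have hd0 : d ≠ 0 := by rintro rfl; exact hd IsSquare.zero
  have hsq : IsSquare (algebraMap (ZMod p) (Fq p) d) := by
    rw [FiniteField.isSquare_iff (by rwa [ringChar.eq (Fq p) p]) (by simpa using hd0),
      ← Nat.card_eq_fintype_card, GaloisField.card p 2 two_ne_zero, ← map_pow]
    obtain ⟨m, hm⟩ := (Fact.out : p.Prime).eq_two_or_odd'.resolve_left hp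
    -- The Euler exponent `(p² - 1)/2` is a multiple of `p - 1`, so it kills `d`.
    have : p ^ 2 / 2 = (p - 1) * (m + 1) := by
      subst hm
      have : (2 * m + 1) ^ 2 = 2 * (2 * m * (m + 1)) + 1 := by ring
      rw [this, Nat.add_sub_cancel]; omega
    rw [this, pow_mul, ZMod.pow_card_sub_one_eq_one hd0, one_pow, map_one]
  obtain ⟨s, hs⟩ := hsq
  exact ⟨d, s, hd, by rw [hs, sq]⟩

section Coordinates

variable {p} {d : ZMod p} {s : Fq p}

theorem bijective_coordinates (hd : ¬ IsSquare d) (hs : s ^ 2 = algebraMap (ZMod p) (Fq p) d) :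
    Function.Bijective fun ab : ZMod p × ZMod p =>
      algebraMap (ZMod p) (Fq p) ab.1 + algebraMap (ZMod p) (Fq p) ab.2 * s := by
  rw [Fintype.bijective_iff_injective_and_card]
  constructor
  · rintro ⟨a, b⟩ ⟨a', b'⟩ h
    simp only at h
    have h1 : algebraMap (ZMod p) (Fq p) (b - b') * s = algebraMap (ZMod p) (Fq p) (a' - a) := by
      rw [map_sub, map_sub]; linear_combination h
    have hb : b - b' = 0 := by
      by_contra hb
      apply hd
      refine ⟨(a' - a) / (b - b'), (algebraMap (ZMod p) (Fq p)).injective ?_⟩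
      have hb' : algebraMap (ZMod p) (Fq p) (b - b') ≠ 0 := (map_ne_zero _).mpr hb
      rw [← hs, map_mul, map_div₀, ← h1]
      field_simp
    rw [hb, map_zero, zero_mul, eq_comm, map_eq_zero] at h1
    rw [sub_eq_zero] at h1 hb
    rw [h1, hb]
  · rw [← Nat.card_eq_fintype_card (α := Fq p), GaloisField.card p 2 two_ne_zero, Fintype.card_prod,
      ZMod.card, sq]

/-- Euler's criterion gives `s^p = d^{(p-1)/2} s = -s`: Frobenius is conjugation. -/
theorem frobenius_coordinates (hp : p ≠ 2) (hd : ¬ IsSquare d)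
    (hs : s ^ 2 = algebraMap (ZMod p) (Fq p) d) (a b : ZMod p) :
    (algebraMap (ZMod p) (Fq p) a + algebraMap (ZMod p) (Fq p) b * s) ^ p =
      algebraMap (ZMod p) (Fq p) a - algebraMap (ZMod p) (Fq p) b * s := by
  have hsp : s ^ p = -s := by
    obtain ⟨m, hm⟩ := (Fact.out : p.Prime).eq_two_or_odd'.resolve_left hp
    have hdm : d ^ m = -1 := by
      have h := quadraticChar_eq_pow_of_char_ne_two' (F := ZMod p) (by rwa [ZMod.ringChar_zmod_n]) d
      rw [quadraticChar_neg_one_iff_not_isSquare.mpr hd, ZMod.card,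
        show p / 2 = m by omega] at h
      rw [← h]; simp
    calc s ^ p = s ^ (2 * m + 1) := congrArg _ hm
      _ = -s := by rw [pow_succ, pow_mul, hs, ← map_pow, hdm]; simp
  rw [add_pow_char, mul_pow, hsp, ← map_pow, ← map_pow, ZMod.pow_card, ZMod.pow_card]; ring

theorem half_trace_coordinates (hp : p ≠ 2) (hd : ¬ IsSquare d)
    (hs : s ^ 2 = algebraMap (ZMod p) (Fq p) d) (a b : ZMod p) :
    2⁻¹ * Algebra.trace (ZMod p) (Fq p)
      (algebraMap (ZMod p) (Fq p) a + algebraMap (ZMod p) (Fq p) b * s) = a := by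
  have h : Algebra.trace (ZMod p) (Fq p)
      (algebraMap (ZMod p) (Fq p) a + algebraMap (ZMod p) (Fq p) b * s) = 2 * a := by
    apply (algebraMap (ZMod p) (Fq p)).injective
    rw [FiniteField.algebraMap_trace_eq_sum_pow, GaloisField.finrank p two_ne_zero, Nat.card_zmod,
      Finset.sum_range_succ, Finset.sum_range_one, pow_zero, pow_one, pow_one,
      frobenius_coordinates hp hd hs, map_mul, map_ofNat]
    ring
  have h2 : (2 : ZMod p) ≠ 0 := by
    have := Ring.two_ne_zero (R := ZMod p) (by rwa [ZMod.ringChar_zmod_n])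
    exact this
  rw [h, inv_mul_cancel_left₀ h2]

theorem norm_coordinates (hp : p ≠ 2) (hd : ¬ IsSquare d)
    (hs : s ^ 2 = algebraMap (ZMod p) (Fq p) d) (a b : ZMod p) :
    Algebra.norm (ZMod p) (algebraMap (ZMod p) (Fq p) a + algebraMap (ZMod p) (Fq p) b * s) =
      a ^ 2 - d * b ^ 2 := by
  apply (algebraMap (ZMod p) (Fq p)).injective
  rw [algebraMap_norm_Fq, pow_succ, frobenius_coordinates hp hd hs, map_sub, map_mul, map_pow,
    map_pow, ← hs]
  ring

end Coordinates

/-! ### Bernoulli numbers and the factorization of `S`. -/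

theorem b2_eq (t : ZMod p) : b2 p t = ((t.val : ℚ) / p) ^ 2 - (t.val : ℚ) / p + 1 / 6 := by
  rw [b2, Polynomial.bernoulli_def]
  simp [Finset.sum_range_succ, bernoulli_one, bernoulli_two]
  ring

theorem genBernoulli2_omega (k : ℕ) : genBernoulli2 p (teichmuller p ^ k) =
    p * ∑ a : ZMod p, ((omegaChar p ^ k) a : ℤ_[p]) * ((b2 p a : ℚ) : ℚ_[p]) := by
  rw [genBernoulli2, ← sum_units_eq_sum
    (fun a : ZMod p => ((omegaChar p ^ k) a : ℤ_[p]) * ((b2 p a : ℚ) : ℚ_[p]))]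
  · congr 1
    refine Finset.sum_congr rfl fun a _ => ?_
    rw [omegaChar_pow_coe]; simp
  · rw [MulChar.map_zero, PadicInt.coe_zero, zero_mul]

theorem p_mul_genBernoulli2_omega (k : ℕ) : p * genBernoulli2 p (teichmuller p ^ k) =
    ((∑ a : ZMod p, (omegaChar p ^ k) a * (a.val : ℤ_[p]) ^ 2 : ℤ_[p]) : ℚ_[p]) -
    p * ((∑ a : ZMod p, (omegaChar p ^ k) a * (a.val : ℤ_[p]) : ℤ_[p]) : ℚ_[p]) +
    p ^ 2 / 6 * ((∑ a : ZMod p, (omegaChar p ^ k) a : ℤ_[p]) : ℚ_[p]) := by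
  have hp0 : (p : ℚ_[p]) ≠ 0 := by exact_mod_cast (Fact.out : p.Prime).ne_zero
  rw [genBernoulli2_omega]
  simp only [PadicInt.coe_sum, Finset.mul_sum]
  rw [← Finset.sum_sub_distrib, ← Finset.sum_add_distrib]
  refine Finset.sum_congr rfl fun a _ => ?_
  rw [b2_eq, PadicInt.coe_mul, PadicInt.coe_mul, PadicInt.coe_pow, PadicInt.coe_natCast]
  push_cast
  field_simp

theorem four_mul_S_eq (hp : p ≠ 2) {j : ℕ} (hj : omegaChar p ^ (2 * j) ≠ 1) :
    ∃ c : ℤ_[p], 4 * S p (phi p ^ j) =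
      -(jacobiSum (omegaChar p ^ (2 * j)) (omegaChar p ^ ((p - 1) / 2)) : ℤ_[p]) *
        bPrime p (phi p ^ j) +
      p / 6 * ((c * ∑ b : ZMod p, (omegaChar p ^ (4 * j)) b : ℤ_[p]) : ℚ_[p]) := by
  obtain ⟨d, s, hd, hs⟩ := exists_sq_eq_nonsquare p hp
  have h4 (a : ZMod p) : (omegaChar p ^ (2 * j)) (a ^ 2) = (omegaChar p ^ (4 * j)) a := by
    rw [map_pow, ← MulChar.pow_apply' _ two_ne_zero, ← pow_mul]; congr 2; ring
  -- The correction is the row `a = 0`: the norm there is `-db²`, and `B₂(0) = 1/6`.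
  refine ⟨(omegaChar p ^ (2 * j)) (-d), ?_⟩
  rw [four_mul_S p hp, bPrime_phi_pow, genBernoulli2_omega,
    ← (Equiv.ofBijective _ (bijective_coordinates hd hs)).sum_comp, Fintype.sum_prod_type]
  simp only [Equiv.ofBijective_apply, half_trace_coordinates hp hd hs, norm_coordinates hp hd hs]
  have hrow (a : ZMod p) : ∑ b : ZMod p, ((b2 p a : ℚ) : ℚ_[p]) *
      ((omegaChar p ^ (2 * j)) (a ^ 2 - d * b ^ 2) : ℤ_[p]) =
      -(jacobiSum (omegaChar p ^ (2 * j)) (omegaChar p ^ ((p - 1) / 2)) : ℤ_[p]) *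
        (((omegaChar p ^ (4 * j)) a : ℤ_[p]) * ((b2 p a : ℚ) : ℚ_[p])) +
      if a = 0 then 1 / 6 * (((omegaChar p ^ (2 * j)) (-d) *
        ∑ b : ZMod p, (omegaChar p ^ (4 * j)) b : ℤ_[p]) : ℚ_[p]) else 0 := by
    rw [← Finset.mul_sum, ← PadicInt.coe_sum]
    split_ifs with ha
    · subst ha
      have : ∀ b : ZMod p, (0 : ZMod p) ^ 2 - d * b ^ 2 = -d * b ^ 2 := fun b => by ring
      simp_rw [this, map_mul, h4]
      rw [MulChar.map_zero, ← Finset.mul_sum, b2_eq]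
      simp
    · rw [← PadicInt.coe_neg, ← sum_omegaChar_one_sub_mul_sq p hp hd hj, add_zero, ← mul_assoc,
        mul_comm]
      have hscale : ∑ b : ZMod p, (omegaChar p ^ (2 * j)) (a ^ 2 - d * b ^ 2) =
          (∑ c : ZMod p, (omegaChar p ^ (2 * j)) (1 - d * c ^ 2)) * (omegaChar p ^ (4 * j)) a := by
        rw [Finset.sum_mul, ← Equiv.sum_comp (Equiv.mulLeft₀ a ha)]
        refine Finset.sum_congr rfl fun c _ => ?_
        rw [← h4, ← map_mul, Equiv.mulLeft₀_apply]
        congr 1; ring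
      rw [hscale, PadicInt.coe_mul]
  simp_rw [hrow]
  rw [Finset.sum_add_distrib, Finset.sum_ite_eq', ← Finset.mul_sum]
  simp only [Finset.mem_univ, if_true]
  ring

/-! ### Orders of the Bernoulli numbers and of `S`. -/

theorem ordp_coe_nonneg (x : ℤ_[p]) : 0 ≤ ordp p (x : ℚ_[p]) := by
  by_cases hx : x = 0
  · rw [hx, PadicInt.coe_zero, ordp, AddValuation.map_zero]; exact le_top
  · rw [ordp, Padic.addValuation.apply (PadicInt.coe_ne_zero.mpr hx)]
    exact WithTop.coe_le_coe.mpr PadicInt.valuation_coe_nonneg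

theorem ordp_coe_of_isUnit {x : ℤ_[p]} (hx : IsUnit x) : ordp p (x : ℚ_[p]) = 0 := by
  obtain ⟨y, hy⟩ := hx.exists_right_inv
  have h : ordp p (x : ℚ_[p]) + ordp p (y : ℚ_[p]) = 0 := by
    rw [ordp, ordp, ← AddValuation.map_mul, ← PadicInt.coe_mul, hy, PadicInt.coe_one,
      AddValuation.map_one]
  exact ((add_eq_zero_iff_of_nonneg (ordp_coe_nonneg p x) (ordp_coe_nonneg p y)).mp h).1

theorem ordp_p : ordp p (p : ℚ_[p]) = 1 := by
  rw [ordp, Padic.addValuation.apply (by exact_mod_cast (Fact.out : p.Prime).ne_zero),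
    Padic.valuation_p]
  rfl

theorem isUnit_natCast_of_not_dvd {n : ℕ} (hn : ¬ p ∣ n) : IsUnit (n : ℤ_[p]) := by
  rwa [isUnit_iff_toZMod_ne_zero, map_natCast, Ne, ZMod.natCast_eq_zero_iff]

theorem ordp_natCast_mul {n : ℕ} (hn : ¬ p ∣ n) (x : ℚ_[p]) : ordp p (n * x) = ordp p x := by
  rw [ordp, AddValuation.map_mul, ← PadicInt.coe_natCast]
  exact (congrArg (· + _) (ordp_coe_of_isUnit p (isUnit_natCast_of_not_dvd p hn))).trans
    (zero_add _)

theorem not_dvd_twentyFour (hp : 5 ≤ p) : ¬ p ∣ 24 := by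
  have hpp : p.Prime := Fact.out
  rw [show 24 = 2 ^ 3 * 3 by norm_num, hpp.dvd_mul]
  rintro (h | h)
  · have := Nat.le_of_dvd (by norm_num) (hpp.dvd_of_dvd_pow h); omega
  · have := Nat.le_of_dvd (by norm_num) h; omega

theorem toZMod_secondMoment (k : ℕ) (hk : k ≠ 0) :
    PadicInt.toZMod (∑ a : ZMod p, (omegaChar p ^ k) a * (a.val : ℤ_[p]) ^ 2) =
      if (p - 1) ∣ k + 2 then -1 else 0 := by
  rw [← sum_pow_zmod p (k + 2) (by omega), map_sum]
  refine Finset.sum_congr rfl fun a _ => ?_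
  rw [map_mul, toZMod_omegaChar_pow p hk, map_pow, map_natCast, ZMod.natCast_zmod_val, pow_add]

theorem ordp_p_mul (x : ℚ_[p]) : ordp p (p * x) = 1 + ordp p x := by
  rw [ordp, AddValuation.map_mul]
  exact congrArg (· + _) (ordp_p p)

theorem ordp_genBernoulli2_nonneg {k : ℕ} (hk : ¬ (p - 1) ∣ k) (hk2 : ¬ (p - 1) ∣ k + 2) :
    0 ≤ ordp p (genBernoulli2 p (teichmuller p ^ k)) := by
  have hp0 : (p : ℚ_[p]) ≠ 0 := by exact_mod_cast (Fact.out : p.Prime).ne_zero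
  have hk0 : k ≠ 0 := by rintro rfl; exact hk (dvd_zero _)
  have hM := toZMod_secondMoment p k hk0
  rw [if_neg hk2, ← dvd_iff_toZMod_eq_zero] at hM
  obtain ⟨m, hm⟩ := hM
  have h := p_mul_genBernoulli2_omega p k
  rw [MulChar.sum_eq_zero_of_ne_one (omegaChar_pow_ne_one p hk), hm, PadicInt.coe_mul,
    PadicInt.coe_natCast, PadicInt.coe_zero, mul_zero, add_zero, ← mul_sub,
    ← PadicInt.coe_sub] at h
  rw [mul_left_cancel₀ hp0 h]
  exact ordp_coe_nonneg p _

/-- Here `p B_{2,ω^k} ≡ -1 mod p`, a unit. -/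
theorem one_add_ordp_genBernoulli2 {k : ℕ} (hk : ¬ (p - 1) ∣ k) (hk2 : (p - 1) ∣ k + 2) :
    1 + ordp p (genBernoulli2 p (teichmuller p ^ k)) = 0 := by
  have hk0 : k ≠ 0 := by rintro rfl; exact hk (dvd_zero _)
  have h := p_mul_genBernoulli2_omega p k
  rw [MulChar.sum_eq_zero_of_ne_one (omegaChar_pow_ne_one p hk), PadicInt.coe_zero, mul_zero,
    add_zero, ← PadicInt.coe_natCast, ← PadicInt.coe_mul, ← PadicInt.coe_sub,
    PadicInt.coe_natCast] at h
  rw [← ordp_p_mul, h]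
  apply ordp_coe_of_isUnit
  rw [isUnit_iff_toZMod_ne_zero, map_sub, toZMod_secondMoment p k hk0, if_pos hk2]
  simp

theorem four_mul_S_eq_jacobiSum_mul (hp : p ≠ 2) {j : ℕ} (hj : ¬ (p - 1) ∣ 4 * j) :
    ((4 : ℕ) : ℚ_[p]) * S p (phi p ^ j) =
      ((-jacobiSum (omegaChar p ^ (2 * j)) (omegaChar p ^ ((p - 1) / 2)) : ℤ_[p]) : ℚ_[p]) *
        bPrime p (phi p ^ j) := by
  have h2 : ¬ (p - 1) ∣ 2 * j := fun h => hj ((h.mul_left 2).trans (by rw [← mul_assoc]; norm_num))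
  obtain ⟨c, hc⟩ := four_mul_S_eq p hp (omegaChar_pow_ne_one p h2)
  rw [MulChar.sum_eq_zero_of_ne_one (omegaChar_pow_ne_one p hj)] at hc
  rw [PadicInt.coe_neg, Nat.cast_ofNat, hc, mul_zero, PadicInt.coe_zero, mul_zero, add_zero]

theorem ordp_S_of_lt (hp : 5 ≤ p) {j : ℕ} (hj0 : 0 < j) (hj : 4 * j < p - 1) :
    ordp p (S p (phi p ^ j)) = 1 + ordp p (bPrime p (phi p ^ j)) := by
  have hodd := (Fact.out : p.Prime).eq_two_or_odd.resolve_left (by omega)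
  obtain ⟨u, hu⟩ := jacobiSum_eq_mul_unit p (a := 2 * j) (b := (p - 1) / 2) (by omega) (by omega)
    (by omega)
  rw [← ordp_natCast_mul p (n := 4) (Nat.not_dvd_of_pos_of_lt (by norm_num) (by omega)),
    four_mul_S_eq_jacobiSum_mul p (by omega)
    (fun h => by have := Nat.le_of_dvd (by omega) h; omega), hu, ← mul_neg, PadicInt.coe_mul,
    PadicInt.coe_natCast, mul_assoc, ordp_p_mul, ordp, AddValuation.map_mul]
  have := ordp_coe_of_isUnit p u.isUnit.neg
  rw [ordp] at this
  rw [this, zero_add]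

theorem ordp_S_of_gt (hp : 5 ≤ p) {j : ℕ} (hj : p - 1 < 4 * j) (hj' : j ≤ (p - 3) / 2) :
    ordp p (S p (phi p ^ j)) = ordp p (bPrime p (phi p ^ j)) := by
  have hodd := (Fact.out : p.Prime).eq_two_or_odd.resolve_left (by omega)
  have hu := isUnit_jacobiSum p (a := 2 * j) (b := (p - 1) / 2) (by omega) (by omega) (by omega)
  have hd : ¬ (p - 1) ∣ 4 * j := by
    rintro ⟨m, hm⟩
    have h1 : 1 < m := by by_contra h; nlinarith [Nat.mul_le_mul_left (p - 1) (not_lt.mp h)]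
    have := Nat.mul_le_mul_left (p - 1) (show 2 ≤ m from h1)
    omega
  rw [← ordp_natCast_mul p (n := 4) (Nat.not_dvd_of_pos_of_lt (by norm_num) (by omega)),
    four_mul_S_eq_jacobiSum_mul p (by omega) hd,
    ordp, AddValuation.map_mul]
  have := ordp_coe_of_isUnit p hu.neg
  rw [ordp] at this
  rw [this, zero_add]

/-- The trivial character still vanishes at `0`, so only `1 ≤ a ≤ p - 1` count, and the classical
power sums apply. -/
theorem six_mul_genBernoulli2_one :
    6 * genBernoulli2 p (teichmuller p ^ (p - 1)) = ((1 - p : ℤ_[p]) : ℚ_[p]) := by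
  have hp0 : (p : ℚ_[p]) ≠ 0 := by exact_mod_cast (Fact.out : p.Prime).ne_zero
  have hsum (f : ℕ → ℤ_[p]) : ∑ a : ZMod p, (omegaChar p ^ (p - 1)) a * f a.val =
      (∑ i ∈ Finset.range p, f i) - f 0 := by
    have h (a : ZMod p) : (omegaChar p ^ (p - 1)) a * f a.val =
        f a.val - if a = 0 then f 0 else 0 := by
      rw [omegaChar_pow_card_sub_one]
      split_ifs with ha
      · rw [ha, MulChar.map_zero, ZMod.val_zero]; ring
      · rw [MulChar.one_apply (isUnit_iff_ne_zero.mpr ha)]; ring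
    simp_rw [h]
    rw [Finset.sum_sub_distrib, Finset.sum_ite_eq', if_pos (Finset.mem_univ _)]
    congr 1
    refine Finset.sum_bij (fun a _ => a.val) ?_ ?_ ?_ ?_
    · intro a _; exact Finset.mem_range.mpr (ZMod.val_lt a)
    · intro a _ b _ h; exact ZMod.val_injective p h
    · intro i hi
      exact ⟨(i : ZMod p), Finset.mem_univ _, ZMod.val_cast_of_lt (Finset.mem_range.mp hi)⟩
    · intro a _; rfl
  have h1 (n : ℕ) : 2 * ∑ i ∈ Finset.range n, (i : ℤ_[p]) = n * (n - 1) := by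
    induction n with
    | zero => simp
    | succ n ih => rw [Finset.sum_range_succ, mul_add, ih]; push_cast; ring
  have h2 (n : ℕ) : 6 * ∑ i ∈ Finset.range n, (i : ℤ_[p]) ^ 2 = n * (n - 1) * (2 * n - 1) := by
    induction n with
    | zero => simp
    | succ n ih => rw [Finset.sum_range_succ, mul_add, ih]; push_cast; ring
  have m0 := hsum fun _ => 1
  have m1 := hsum fun i => (i : ℤ_[p])
  have m2 := hsum fun i => (i : ℤ_[p]) ^ 2
  simp only [mul_one, Finset.sum_const, Finset.card_range, nsmul_eq_mul, Nat.cast_zero, sub_zero,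
    ne_eq, OfNat.ofNat_ne_zero, not_false_eq_true, zero_pow] at m0 m1 m2
  have h := p_mul_genBernoulli2_omega p (p - 1)
  rw [m0, m1, m2] at h
  have e1 := congrArg (fun x : ℤ_[p] => (x : ℚ_[p])) (h1 p)
  have e2 := congrArg (fun x : ℤ_[p] => (x : ℚ_[p])) (h2 p)
  simp only [PadicInt.coe_mul, PadicInt.coe_sub, PadicInt.coe_natCast, PadicInt.coe_one,
    show ((2 : ℤ_[p]) : ℚ_[p]) = 2 from rfl, show ((6 : ℤ_[p]) : ℚ_[p]) = 6 from rfl] at e1 e2 h ⊢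
  apply mul_left_cancel₀ hp0
  linear_combination 6 * h + e2 - 3 * p * e1

theorem ordp_S_of_eq (hp : 5 ≤ p) {j : ℕ} (hj : 4 * j = p - 1) :
    ordp p (S p (phi p ^ j)) = 0 := by
  have hne : omegaChar p ^ (2 * j) ≠ 1 :=
    omegaChar_pow_ne_one p fun h => by have := Nat.le_of_dvd (by omega) h; omega
  obtain ⟨c, hc⟩ := four_mul_S_eq p (by omega) hne
  have hu := isUnit_jacobiSum p (a := 2 * j) (b := (p - 1) / 2) (by omega) (by omega) (by omega)
  set J := jacobiSum (omegaChar p ^ (2 * j)) (omegaChar p ^ ((p - 1) / 2))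
  set M := ∑ b : ZMod p, (omegaChar p ^ (4 * j)) b
  have hB := six_mul_genBernoulli2_one p
  rw [← hj, ← bPrime_phi_pow] at hB
  -- The factor `24 = 4 · 6` also clears the denominator of `B₂`; mod `p` only `-J` remains.
  have h24 : ((24 : ℕ) : ℚ_[p]) * S p (phi p ^ j) =
      ((-J * (1 - p) + p * (c * M) : ℤ_[p]) : ℚ_[p]) := by
    rw [PadicInt.coe_add, PadicInt.coe_mul, ← hB, PadicInt.coe_mul, PadicInt.coe_neg,
      PadicInt.coe_natCast]
    push_cast
    rw [PadicInt.coe_mul] at hc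
    linear_combination 6 * hc
  rw [← ordp_natCast_mul p (not_dvd_twentyFour p hp), h24]
  apply ordp_coe_of_isUnit
  rw [isUnit_iff_toZMod_ne_zero] at hu ⊢
  simpa using hu

theorem ordp_bPrime_nonneg (hp : 5 ≤ p) {j : ℕ} (hj0 : 0 < j) (hj : j ≤ (p - 3) / 2)
    (h4 : 4 * j ≠ p - 1) (h42 : 4 * j + 2 ≠ p - 1) : 0 ≤ ordp p (bPrime p (phi p ^ j)) := by
  -- Both `4j` and `4j + 2` lie below `2(p - 1)`, so `p - 1` is the only multiple to exclude.
  have key {n : ℕ} (h0 : 0 < n) (hn : n < 2 * (p - 1)) (hne : n ≠ p - 1) : ¬ (p - 1) ∣ n := by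
    rintro ⟨m, rfl⟩
    have h1 : m < 2 := by
      by_contra h
      nlinarith [Nat.mul_le_mul_left (p - 1) (not_lt.mp h)]
    interval_cases m <;> omega
  rw [bPrime_phi_pow]
  exact ordp_genBernoulli2_nonneg p (key (by omega) (by omega) h4) (key (by omega) (by omega) h42)

end CuspidalNS

theorem mainTheorem3 (p : ℕ) [Fact p.Prime] (hp : 5 ≤ p) :
    (p % 4 = 1 →
      (∀ j : ℕ, 1 ≤ j → j ≤ (p - 5) / 4 →
        ordp p (S p (phi p ^ j)) = 1 + ordp p (bPrime p (phi p ^ j)) ∧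
        1 ≤ 1 + ordp p (bPrime p (phi p ^ j))) ∧
      ordp p (S p (phi p ^ ((p - 1) / 4))) = 0 ∧
      (∀ j : ℕ, (p + 3) / 4 ≤ j → j ≤ (p - 3) / 2 →
        ordp p (S p (phi p ^ j)) = ordp p (bPrime p (phi p ^ j)) ∧
        0 ≤ ordp p (bPrime p (phi p ^ j)))) ∧
    (p % 4 = 3 →
      (∀ j : ℕ, 1 ≤ j → j ≤ (p - 7) / 4 →
        ordp p (S p (phi p ^ j)) = 1 + ordp p (bPrime p (phi p ^ j)) ∧
        1 ≤ 1 + ordp p (bPrime p (phi p ^ j))) ∧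
      (ordp p (S p (phi p ^ ((p - 3) / 4))) = 1 + ordp p (bPrime p (phi p ^ ((p - 3) / 4))) ∧
        1 + ordp p (bPrime p (phi p ^ ((p - 3) / 4))) = 0) ∧
      (∀ j : ℕ, (p + 1) / 4 ≤ j → j ≤ (p - 3) / 2 →
        ordp p (S p (phi p ^ j)) = ordp p (bPrime p (phi p ^ j)) ∧
        0 ≤ ordp p (bPrime p (phi p ^ j)))) := by
  refine ⟨fun h1 => ⟨fun j hj0 hj => ⟨ordp_S_of_lt p hp hj0 (by omega), ?_⟩,
    ordp_S_of_eq p hp (by omega), fun j hj0 hj => ⟨ordp_S_of_gt p hp (by omega) hj, ?_⟩⟩,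
    fun h3 => ⟨fun j hj0 hj => ⟨ordp_S_of_lt p hp hj0 (by omega), ?_⟩,
    ⟨ordp_S_of_lt p hp (by omega) (by omega), ?_⟩,
    fun j hj0 hj => ⟨ordp_S_of_gt p hp (by omega) hj, ?_⟩⟩⟩
  · exact le_add_of_nonneg_right
      (ordp_bPrime_nonneg p hp hj0 (by omega) (by omega) (by omega))
  · exact ordp_bPrime_nonneg p hp (by omega) hj (by omega) (by omega)
  · exact le_add_of_nonneg_right
      (ordp_bPrime_nonneg p hp hj0 (by omega) (by omega) (by omega))
  · rw [bPrime_phi_pow]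
    exact one_add_ordp_genBernoulli2 p
      (fun h => by have := Nat.le_of_dvd (by omega) h; omega) ⟨1, by omega⟩
  · exact ordp_bPrime_nonneg p hp (by omega) hj (by omega) (by omega)
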